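/- **Setting.** Let $X$ be a compact Polish space with a lamination $\mathcal F$, i.e. a maximal atlas of foliated charts $\varphi:U\to B\times S$ ($U\subset X$ open, $B$ an open ball of a Euclidean space, $S$ a Polish space) whose changes of coordinates are locally of the form $(x,s)\mapsto(f(x,s),g(s))$; the sets $\varphi^{-1}(B\times\{s\})$ are plaques, the plaques of all charts generate the leaf topology, and its connected components are the leaves. A finite regular atlas is a finite family $\mathcal U=\{(U_i,\varphi_i)\}_{i=1}^m$ of charts of $\mathcal F$ covering $X$, with $\varphi_i:U_i\to B_i\times S_i$, such that each plaque of $U_i$ meets at most one plaque of $U_j$, and whenever $U_i\cap U_j\ne\emptyset$ there is a chart of $\mathcal F$ on an open set containing $U_i\cup U_j$ which restricts to the charts of $U_i$ and $U_j$ up to leafwise parametrization (that is, $S_i$ and $S_j$ are identified with open subsets of its transverse space, compatibly with the projections). Let $T=\bigsqcup_i S_i$, and let $S^{\mathcal U}$ be the finite symmetric set consisting of the holonomy maps $g_{ij}$ (sending the plaque of $x$ in $U_i$ to the plaque of $x$ in $U_j$, for $x\in U_i\cap U_j\neq\emptyset$) and the identity maps of their domains. The pseudogroup on $T$ generated by $S^{\mathcal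 U}$ is the holonomy pseudogroup $\Gamma$. Let $\Lambda\neq0$ be a $\Gamma$-invariant regular Borel measure on $T$, finite on compact sets. It extends to transverse sets $Z\subset X$ (Borel sets meeting each leaf in a countable set): partition $Z$ into Borel sets $Z_i\subset U_i$ and put $\Lambda(Z)=\sum_i\int_{S_i}\#(Z_i\cap \text{plaque of } s)\,d\Lambda(s)$. **Secondary category.** A tangential contraction of an open set $W\subset X$ is a continuous map $H:W\times[0,1]\to X$ with $H(x,0)=x$, sending each $L\times[0,1]$, $L$ a leaf of $\mathcal F|_W$, into a leaf of $\mathcal F$, and such that $H(-,1)$ is constant on the leaves of $\mathcal F|_W$. Let $\mathcal V$ be any finite regular atlas of $\mathcal F$. The length of a path is the least number of plaques of $\mathcal V$ in a finite sequence of plaques, each meeting the next one, whose union contains the path; the length of $H$ is the supremum of the lengths of the paths $H(x,-)$. Let $$\operatorname{Cat}(\mathcal F,\Lambda,n,\mathcal V)=\inf_{\mathcal W}\sum_{W\in\mathcal W}\ \inf_{H}\Lambda\big(H(W\times\{1\})\big),$$ where $\mathcal W$ runs over the open coverings of $X$ and $H$ over the tangential contractions of $W$ of length $\le n$ ($\inf\emptyset=\infty$);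 $\operatorname{Cat}(\mathcal F,\Lambda)$ is defined in the same way without restriction on the length. Assume $\operatorname{Cat}(\mathcal F,\Lambda)=0$. For non-decreasing sequences write $g\preceq h$ if there are $B\in\mathbb N$ and $A>0$ with $g(n)\le A\,h(Bn)$ for all $n$; growth types are the classes $[g]$ of the equivalence relation $g\preceq h\preceq g$, ordered by $\preceq$. Then $\operatorname{Cat}_{\mathrm{II}}(\mathcal F,\Lambda)=[1/\operatorname{Cat}(\mathcal F,\Lambda,n,\mathcal V)]$, with $1/\infty=0$ and $1/0=\infty$. **Growth.** Let $S^{\mathcal U,\Lambda}$ be the set of partial maps that the elements of $S^{\mathcal U}$ induce on the support of $\Lambda$, and $S^{\mathcal U,\Lambda}_n$ the set of compositions of at most $n$ (and at least one) elements of $S^{\mathcal U,\Lambda}$, each on its maximal domain. Put $\operatorname{growth}_{S^{\mathcal U},\Lambda}(\Gamma)=[\#S^{\mathcal U,\Lambda}_n]$. **Proposition.** For all $X,\mathcal F,\mathcal U,\mathcal V,\Lambda$ as above, $$\operatorname{Cat}_{\mathrm{II}}(\mathcal F,\Lambda)\le\operatorname{growth}_{S^{\mathcal U},\Lambda}(\Gamma).$$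 -/

import Mathlib

open Set Topology MeasureTheory TopologicalSpace
open scoped ENNReal NNReal

universe u

noncomputable section

namespace MeasuredLamination

/-! Foliated charts and laminations -/

/-- A foliated chart of `X`: a homeomorphism from an open subset of `X` onto the product of an open
ball of a Euclidean space and a Polish space `S`. -/
structure FoliatedChart (X : Type u) [TopologicalSpace X] where
  /-- the leafwise dimension of the chart -/
  dim : ℕ
  /-- the transverse model space -/
  S : Type u
  [topS : TopologicalSpace S]
  [polishS : PolishSpace S]
  /-- the homeomorphism -/
  φ : OpenPartialHomeomorph X (EuclideanSpace ℝ (Fin dim) × S)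
  center : EuclideanSpace ℝ (Fin dim)
  radius : ℝ
  radius_pos : 0 < radius
  target_eq : φ.target = Metric.ball center radius ×ˢ (univ : Set S)

attribute [instance] FoliatedChart.topS FoliatedChart.polishS

section Charts

variable {X : Type u} [TopologicalSpace X]

/-- The open set on which the chart is defined. -/
def FoliatedChart.source (c : FoliatedChart X) : Set X := c.φ.source

/-- The projection to the transverse model (meaningful on `c.source`). -/
def FoliatedChart.proj (c : FoliatedChart X) (x : X) : c.S := (c.φ x).2

/-- The plaque of the chart with transverse coordinate `s`. -/
def FoliatedChart.plaque (c : FoliatedChart X) (s : c.S) : Set X :=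
  {x | x ∈ c.source ∧ c.proj x = s}

/-- The change of coordinates from `c` to `d` is locally of the form
`(x, s) ↦ (f (x, s), g s)` with `g` continuous. (That `f` is continuous is automatic.) -/
def FoliatedChart.ChangePreservesPlaques (c d : FoliatedChart X) : Prop :=
  ∀ x ∈ c.source ∩ d.source, ∃ W : Set X, IsOpen W ∧ x ∈ W ∧ W ⊆ c.source ∩ d.source ∧
    ∃ g : c.S → d.S, ContinuousOn g (c.proj '' W) ∧ ∀ y ∈ W, d.proj y = g (c.proj y)

/-- `d` is, up to the leafwise parametrization, the restriction of the chart `c` to `d.source`: the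
transverse model of `d` is identified with an open subset of that of `c`, compatibly with the
projections. In particular distinct plaques of `d` lie in distinct plaques of `c`. -/
def FoliatedChart.Extends (c d : FoliatedChart X) : Prop :=
  d.source ⊆ c.source ∧
    ∃ e : d.S → c.S, IsOpenEmbedding e ∧ ∀ x ∈ d.source, c.proj x = e (d.proj x)

end Charts

/-- A lamination on `X`: a maximal foliated atlas. -/
structure Lamination (X : Type u) [TopologicalSpace X] where
  /-- all the foliated charts of the lamination -/
  charts : Set (FoliatedChart X)
  covers : ∀ x : X, ∃ c ∈ charts, x ∈ c.source
  compatible : ∀ c ∈ charts, ∀ d ∈ charts, c.ChangePreservesPlaques d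
  maximal : ∀ c : FoliatedChart X,
    (∀ d ∈ charts, c.ChangePreservesPlaques d ∧ d.ChangePreservesPlaques c) → c ∈ charts

section Leaves

variable {X : Type u} [TopologicalSpace X]

/-- The leaf topology, generated by the plaques of all the charts of the lamination. -/
@[reducible] def Lamination.leafTopology (F : Lamination X) : TopologicalSpace X :=
  generateFrom {P | ∃ c ∈ F.charts, ∃ s : c.S, P = c.plaque s}

/-- The leaf through `x`: its connected component in the leaf topology. -/
def Lamination.leaf (F : Lamination X) (x : X) : Set X :=
  @connectedComponent X F.leafTopology x

/-- For `x` in an open set `U`, the leaf through `x` of the lamination that `F` induces on `U`. -/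
def Lamination.leafIn (F : Lamination X) (U : Opens X) (x : X) : Set X :=
  @connectedComponentIn X F.leafTopology (U : Set X) x

/-- A finite regular foliated atlas of the lamination `F`. Local finiteness is automatic. -/
structure RegularAtlas (F : Lamination X) where
  /-- the number of charts -/
  card : ℕ
  chart : Fin card → FoliatedChart X
  chart_mem : ∀ i, chart i ∈ F.charts
  covers : ∀ x : X, ∃ i, x ∈ (chart i).source
  /-- a plaque of a chart meets at most one plaque of any other chart -/
  plaque_inter : ∀ i j (s : (chart i).S), ((chart i).plaque s ∩ (chart j).source).Nonempty →
    ∃ s' : (chart j).S, (chart i).plaque s ∩ (chart j).source ⊆ (chart j).plaque s'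
  /-- any two charts that meet are restrictions of one chart -/
  common_chart : ∀ i j, ((chart i).source ∩ (chart j).source).Nonempty →
    ∃ c ∈ F.charts, c.Extends (chart i) ∧ c.Extends (chart j)

variable {F : Lamination X}

/-- The complete transversal of a regular atlas: the disjoint union of its transverse models. -/
def RegularAtlas.Transversal (U : RegularAtlas F) : Type u := Σ i, (U.chart i).S

instance (U : RegularAtlas F) : TopologicalSpace U.Transversal :=
  inferInstanceAs (TopologicalSpace (Σ i, (U.chart i).S))

instance (U : RegularAtlas F) : MeasurableSpace U.Transversal := borel _

instance (U : RegularAtlas F) : BorelSpace U.Transversal := ⟨rfl⟩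

/-- The plaque of the atlas that corresponds to a point of the transversal. -/
def RegularAtlas.plaque (U : RegularAtlas F) (t : U.Transversal) : Set X :=
  (U.chart t.1).plaque t.2

end Leaves

/-! Pseudogroups. A local transformation of `T` is represented by its graph; thus two local
transformations are equal if and only if they have the same domain and the same values. The
composition `SetRel.comp f g` is "first `f`, then `g`", on its maximal domain. -/

section Pseudogroups

variable {T : Type u}

/-- The relation is the graph of an injective partial map. -/
def IsPartialBijection (R : SetRel T T) : Prop :=
  (∀ a b b', (a, b) ∈ R → (a, b') ∈ R → b = b') ∧ (∀ a a' b, (a, b) ∈ R → (a', b) ∈ R → a = a')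

/-- The pseudogroup generated by `S`: closure of `S` under composition, inversion, restriction to
open sets, and combination. -/
inductive GeneratedPseudogroup [TopologicalSpace T] (S : Set (SetRel T T)) : SetRel T T → Prop
  | base (g : SetRel T T) : g ∈ S → GeneratedPseudogroup S g
  | comp (g h : SetRel T T) : GeneratedPseudogroup S g → GeneratedPseudogroup S h →
      GeneratedPseudogroup S (g.comp h)
  | inv (g : SetRel T T) : GeneratedPseudogroup S g → GeneratedPseudogroup S g.inv
  | restrict (g : SetRel T T) (O : Set T) : IsOpen O → GeneratedPseudogroup S g →
      GeneratedPseudogroup S {p | p ∈ g ∧ p.1 ∈ O}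
  | combine (G : Set (SetRel T T)) : (∀ g ∈ G, GeneratedPseudogroup S g) →
      IsPartialBijection (⋃₀ G) → GeneratedPseudogroup S (⋃₀ G)

/-- A measure on `T` is invariant by a family of local transformations of `T`. -/
def IsInvariantMeasure [MeasurableSpace T] (Γ : SetRel T T → Prop) (Λ : Measure T) : Prop :=
  ∀ g, Γ g → ∀ B : Set T, MeasurableSet B → B ⊆ g.dom → Λ (g.image B) = Λ B

/-- `S_n`: the transformations that are compositions of at most `n` (and at least one) elements
of `S`. -/
def compositions (S : Set (SetRel T T)) (n : ℕ) : Set (SetRel T T) :=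
  {R | ∃ l : List (SetRel T T), l ≠ [] ∧ l.length ≤ n ∧ (∀ g ∈ l, g ∈ S) ∧
    R = l.foldr SetRel.comp SetRel.id}

/-- The family `S^K` of local transformations of `K ⊆ T` that a family `S` of local
transformations of `T` induces. -/
def inducedOn (S : Set (SetRel T T)) (K : Set T) : Set (SetRel K K) :=
  (fun R : SetRel T T => ({p | ((p.1 : T), (p.2 : T)) ∈ R} : SetRel K K)) '' S

end Pseudogroups

/-! Growth types -/

/-- Non-decreasing sequences. The value `∞` is allowed, so that the reciprocal of a sequence with a
zero term makes sense; on real-valued sequences the preorder below is the usual one, and a sequence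
dominated by a real-valued one is real-valued. -/
structure GrowthSequence where
  toFun : ℕ → ℝ≥0∞
  mono : Monotone toFun

/-- `g ≼ h` if `g n ≤ A * h (B * n)` for all `n`, for some `B : ℕ` and some real `A > 0`. -/
instance : Preorder GrowthSequence where
  le g h := ∃ B : ℕ, ∃ A : ℝ≥0, 0 < A ∧ ∀ n, g.toFun n ≤ A * h.toFun (B * n)
  le_refl g := ⟨1, 1, one_pos, fun n => by simp⟩
  le_trans f g h := by
    rintro ⟨B, A, hA, h1⟩ ⟨B', A', hA', h2⟩
    refine ⟨B' * B, A * A', mul_pos hA hA', fun n => (h1 n).trans ?_⟩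
    calc (A : ℝ≥0∞) * g.toFun (B * n) ≤ A * (A' * h.toFun (B' * (B * n))) := by gcongr; exact h2 _
      _ = _ := by push_cast; rw [mul_assoc, mul_assoc]

/-- Growth types: classes of non-decreasing sequences under `g ≼ h ≼ g`, with the induced partial
order. -/
abbrev GrowthType : Type := Antisymmetrization GrowthSequence (· ≤ ·)

/-- The growth type of a non-decreasing sequence. -/
def growthType (g : ℕ → ℝ≥0∞) (hg : Monotone g) : GrowthType :=
  toAntisymmetrization (· ≤ ·) (⟨g, hg⟩ : GrowthSequence)

theorem compositions_mono {T : Type u} (S : Set (SetRel T T)) : Monotone (compositions S) := by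
  rintro m n hmn R ⟨l, h0, h1, h2⟩
  exact ⟨l, h0, h1.trans hmn, h2⟩

/-- The growth `[#S_n]` of the pseudogroup generated by `S`, associated to `S`. -/
def growth {T : Type u} (S : Set (SetRel T T)) : GrowthType :=
  growthType (fun n => ((compositions S n).encard : ℝ≥0∞)) fun m n h => by
    exact ENat.toENNReal_le.2 (Set.encard_le_encard (compositions_mono S h))

/-- The `Λ`-growth of the pseudogroup generated by `S`, associated to `S`: the growth of the
pseudogroup that it induces on the support of `Λ`, associated to the induced generators. -/
def measureGrowth {T : Type u} [TopologicalSpace T] [MeasurableSpace T] (S : Set (SetRel T T))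
    (Λ : Measure T) : GrowthType :=
  growth (inducedOn S Λ.support)

section Lambda

variable {X : Type u} [TopologicalSpace X] {F : Lamination X}

/-! The holonomy pseudogroup of a regular atlas -/

/-- The holonomy map from (an open subset of) the transverse model of the chart `i` to that of the
chart `j`: it sends the plaque of `x` in the chart `i` to the plaque of `x` in the chart `j`. -/
def RegularAtlas.holonomy (U : RegularAtlas F) (i j : Fin U.card) :
    SetRel U.Transversal U.Transversal :=
  {p | ∃ x ∈ (U.chart i).source ∩ (U.chart j).source,
    p = (⟨i, (U.chart i).proj x⟩, ⟨j, (U.chart j).proj x⟩)}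

/-- The finite symmetric system of generators of the holonomy pseudogroup defined by the atlas: the
holonomy maps between intersecting charts (with their inverses), and the identity maps of their
domains (which are also their images). -/
def RegularAtlas.generators (U : RegularAtlas F) : Set (SetRel U.Transversal U.Transversal) :=
  {g | ∃ i j, ((U.chart i).source ∩ (U.chart j).source).Nonempty ∧
    (g = U.holonomy i j ∨ g = {p | p.1 = p.2 ∧ p.1 ∈ (U.holonomy i j).dom})}

/-- The holonomy pseudogroup of the lamination on the transversal of the atlas. -/
def RegularAtlas.holonomyPseudogroup (U : RegularAtlas F) :
    SetRel U.Transversal U.Transversal → Prop :=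
  GeneratedPseudogroup U.generators

/-- The holonomy map from the chart `i` to the chart `j` is a well-defined injective partial map. -/
theorem RegularAtlas.holonomy_isPartialBijection (U : RegularAtlas F) (i j : Fin U.card) :
    IsPartialBijection (U.holonomy i j) := by
  have key : ∀ i j : Fin U.card, ∀ x y, x ∈ (U.chart i).source ∩ (U.chart j).source →
      y ∈ (U.chart i).source ∩ (U.chart j).source →
      (U.chart i).proj x = (U.chart i).proj y → (U.chart j).proj x = (U.chart j).proj y := by
    intro i j x y hx hy h
    obtain ⟨s', hs'⟩ := U.plaque_inter i j ((U.chart i).proj y) ⟨x, ⟨hx.1, h⟩, hx.2⟩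
    exact (hs' ⟨⟨hx.1, h⟩, hx.2⟩).2.trans (hs' ⟨⟨hy.1, rfl⟩, hy.2⟩).2.symm
  constructor
  · rintro a b b' ⟨x, hx, hxe⟩ ⟨y, hy, hye⟩
    obtain ⟨rfl, rfl⟩ := Prod.mk.inj hxe
    obtain ⟨h1, rfl⟩ := Prod.mk.inj hye
    rw [key i j x y hx hy (eq_of_heq (Sigma.mk.inj h1).2)]
  · rintro a a' b ⟨x, hx, hxe⟩ ⟨y, hy, hye⟩
    obtain ⟨rfl, rfl⟩ := Prod.mk.inj hxe
    obtain ⟨rfl, h1⟩ := Prod.mk.inj hye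
    rw [key j i x y hx.symm hy.symm (eq_of_heq (Sigma.mk.inj h1).2)]

/-! Measures of transverse sets -/

/-- The subset of the chart `i` of the points that are in no earlier chart. These sets partition
the space. -/
def RegularAtlas.piece (U : RegularAtlas F) (i : Fin U.card) : Set X :=
  (U.chart i).source \ ⋃ j : {j : Fin U.card // j < i}, (U.chart j).source

/-- The extension of the transverse invariant measure `Λ` to the transverse sets `Z` of `X`: cut `Z`
into pieces contained in charts, and integrate over the transverse model of each chart the number of
points of the piece in each plaque. -/
def RegularAtlas.transverseMeasure (U : RegularAtlas F) (Λ : Measure U.Transversal) (Z : Set X) :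
    ℝ≥0∞ :=
  ∫⁻ t, ((Z ∩ U.piece t.1 ∩ U.plaque t).encard : ℝ≥0∞) ∂Λ

/-! Tangential contractions and their lengths -/

/-- A tangential contraction of the open set `U`: a tangential homotopy (a continuous map
`U × [0,1] → X` that sends each set `L × [0,1]`, with `L` a leaf of `U`, into a leaf) which starts at
the inclusion and ends at a map that is constant on the leaves of `U`. -/
structure TangentialContraction (F : Lamination X) (U : Opens X) where
  H : C(U × unitInterval, X)
  tangential : ∀ x y : U, (y : X) ∈ F.leafIn U x → ∀ s t, H (y, t) ∈ F.leaf (H (x, s))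
  initial : ∀ x : U, H (x, 0) = x
  final : ∀ x y : U, (y : X) ∈ F.leafIn U x → H (y, 1) = H (x, 1)

/-- The final set `H(U × {1})` of a tangential contraction. -/
def TangentialContraction.finalSet {U : Opens X} (H : TangentialContraction F U) : Set X :=
  range fun x : U => H.H (x, 1)

/-- A chain of plaques: a finite sequence of plaques, each of which meets the next one. -/
def RegularAtlas.IsPlaqueChain (V : RegularAtlas F) (l : List V.Transversal) : Prop :=
  l.IsChain fun a b => (V.plaque a ∩ V.plaque b).Nonempty

/-- The length of a path: the least number of plaques in a chain of plaques that covers it. -/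
def RegularAtlas.pathLength (V : RegularAtlas F) (σ : unitInterval → X) : ℕ∞ :=
  ⨅ (l : List V.Transversal) (_ : V.IsPlaqueChain l ∧ range σ ⊆ ⋃ a ∈ l, V.plaque a),
    (l.length : ℕ∞)

/-- The length of a tangential contraction: the supremum of the lengths of its paths. -/
def TangentialContraction.length {U : Opens X} (H : TangentialContraction F U)
    (V : RegularAtlas F) : ℕ∞ :=
  ⨆ x : U, V.pathLength fun t => H.H (x, t)

/-! The `Λ`-category and the secondary `Λ`-category. In the following definitions `Λ` is given on the
transversal of the atlas `U`, and lengths are measured with the atlas `V`. -/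

/-- The infimum of the measures of the final sets of the tangential contractions of `W` of length
at most `r` (it is `∞` if there are none). -/
def tau (U : RegularAtlas F) (Λ : Measure U.Transversal) (V : RegularAtlas F) (r : ℕ∞)
    (W : Opens X) : ℝ≥0∞ :=
  ⨅ (H : TangentialContraction F W) (_ : H.length V ≤ r), U.transverseMeasure Λ H.finalSet

/-- `Cat(F, Λ, r, V)`: the infimum of `∑ W ∈ 𝒲, τ(W)` over the open coverings `𝒲` of `X`, where only
tangential contractions of length at most `r` are used. -/
def catLE (U : RegularAtlas F) (Λ : Measure U.Transversal) (V : RegularAtlas F) (r : ℕ∞) : ℝ≥0∞ :=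
  ⨅ (𝒲 : Set (Opens X)) (_ : ⋃ W ∈ 𝒲, (W : Set X) = univ), ∑' W : 𝒲, tau U Λ V r W

/-- The `Λ`-category `Cat(F, Λ)`: there is no restriction on the lengths. -/
def cat (U : RegularAtlas F) (Λ : Measure U.Transversal) : ℝ≥0∞ := catLE U Λ U ⊤

theorem catLE_antitone (U : RegularAtlas F) (Λ : Measure U.Transversal) (V : RegularAtlas F) :
    Antitone (catLE U Λ V) := by
  intro r r' h
  refine iInf₂_mono fun 𝒲 _ => ENNReal.tsum_le_tsum fun W => ?_
  exact iInf_mono fun H => iInf_mono' fun hH => ⟨hH.trans h, le_rfl⟩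

/-- The secondary `Λ`-category: the growth type of the sequence `1 / Cat(F, Λ, n, V)`. -/
def secondaryCat (U : RegularAtlas F) (Λ : Measure U.Transversal) (V : RegularAtlas F) :
    GrowthType :=
  growthType (fun n => (catLE U Λ V (n : ℕ∞))⁻¹) fun m n h =>
    ENNReal.inv_le_inv.2 (catLE_antitone U Λ V (by exact_mod_cast h))

end Lambda

end MeasuredLamination

end

noncomputable section

namespace MeasuredLamination

/-! Compositions of local transformations -/

section Relations

variable {T : Type u} {S : Set (SetRel T T)}

/-! The core is the bound Λ(T) / #S_{Nn} ≤ Cat(n) (`measure_univ_div_le_catLE`). Here T is the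
transversal of `U`, #S_{Nn} counts the compositions induced on the support of Λ, and N depends only
on `U` and `V`.

Embed T in X by the centres of the plaques. A contraction H of W of length at most n moves the
centre of a plaque t in W along a path. Let f(t) be the plaque of the endpoint in the first chart
that contains it; some composition of at most Nn generators sends t to f(t). Up to a null set, the
set of these t is covered by one piece per induced composition. On each piece f is a
measure-preserving holonomy transformation whose values are plaques meeting H(W × {1}), so the piece
has measure at most Λ(H(W × {1})). Adding up the pieces gives `TangentialContraction.measure_le`; a
finite subcover then gives the bound.

The constant N comes from compactness (`RegularAtlas.exists_withinSteps_of_mem_plaque`): finitely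
many boxes, each adapted to both atlases, cover X, and a connected plaque of `V` is crossed by a
chain of boxes without repetition. -/

theorem foldr_comp_append (l l' : List (SetRel T T)) :
    (l ++ l').foldr SetRel.comp SetRel.id =
      (l.foldr SetRel.comp SetRel.id).comp (l'.foldr SetRel.comp SetRel.id) := by
  induction l with
  | nil => simp
  | cons g l ih => simp only [List.cons_append, List.foldr_cons, ih, SetRel.comp_assoc]

theorem mem_compositions_one {g : SetRel T T} (hg : g ∈ S) : g ∈ compositions S 1 :=
  ⟨[g], by simp, by simp, by simpa using hg, by simp⟩

theorem comp_mem_compositions {m n : ℕ} {R R' : SetRel T T} (hR : R ∈ compositions S m)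
    (hR' : R' ∈ compositions S n) : R.comp R' ∈ compositions S (m + n) := by
  obtain ⟨l, h0, h1, h2, rfl⟩ := hR
  obtain ⟨l', -, h1', h2', rfl⟩ := hR'
  refine ⟨l ++ l', by simp [h0], by simp; omega, ?_, (foldr_comp_append l l').symm⟩
  intro g hg
  rcases List.mem_append.1 hg with hg | hg
  exacts [h2 g hg, h2' g hg]

/-- A property of local transformations which is stable under composition passes from the elements
of `S` to their compositions. -/
theorem compositions_induction {p : SetRel T T → Prop} (base : ∀ g ∈ S, p g)
    (comp : ∀ g h, p g → p h → p (g.comp h)) {n : ℕ} {R : SetRel T T}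
    (hR : R ∈ compositions S n) : p R := by
  obtain ⟨l, h0, -, h2, rfl⟩ := hR
  induction l with
  | nil => exact absurd rfl h0
  | cons g l ih =>
    have hg : p g := base g (h2 g (by simp))
    by_cases hl : l = []
    · subst hl
      simpa using hg
    · exact comp _ _ hg (ih hl fun g hg => h2 g (by simp [hg]))

theorem finite_compositions (hS : S.Finite) (n : ℕ) : (compositions S n).Finite := by
  have := hS.to_subtype
  refine ((List.finite_length_le S n).image
    fun l => (l.map Subtype.val).foldr SetRel.comp SetRel.id).subset ?_
  rintro R ⟨l, -, h1, h2, rfl⟩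
  refine ⟨l.attachWith (· ∈ S) h2, by simpa using h1, ?_⟩
  simp

/-- Lifting generator by generator gives a transformation of the whole space, to which invariance of
the measure applies. -/
theorem exists_compositions_of_mem_inducedOn {K : Set T} {n : ℕ} {R' : SetRel K K}
    (hR' : R' ∈ compositions (inducedOn S K) n) :
    ∃ R ∈ compositions S n, ∀ a b : K, (a, b) ∈ R' → ((a : T), (b : T)) ∈ R := by
  obtain ⟨l, h0, h1, h2, rfl⟩ := hR'
  have : ∀ l : List (SetRel K K), (∀ g ∈ l, g ∈ inducedOn S K) →
      ∃ l₁ : List (SetRel T T), l₁.length = l.length ∧ (∀ g ∈ l₁, g ∈ S) ∧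
        ∀ a b : K, (a, b) ∈ l.foldr SetRel.comp SetRel.id →
          ((a : T), (b : T)) ∈ l₁.foldr SetRel.comp SetRel.id := by
    intro l hl
    induction l with
    | nil => exact ⟨[], rfl, by simp, fun a b h => congrArg Subtype.val h⟩
    | cons g l ih =>
      obtain ⟨l₁, e, hS, hl₁⟩ := ih fun g hg => hl g (by simp [hg])
      obtain ⟨g₁, hg₁, rfl⟩ := hl g (by simp)
      refine ⟨g₁ :: l₁, by simp [e], ?_, ?_⟩
      · intro h hh
        rcases List.mem_cons.1 hh with rfl | hh
        exacts [hg₁, hS h hh]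
      · rintro a b ⟨c, hac, hcb⟩
        exact ⟨c, hac, hl₁ c b hcb⟩
  obtain ⟨l₁, e, hS, hl₁⟩ := this l h2
  refine ⟨_, ⟨l₁, ?_, e.trans_le h1, hS, rfl⟩, hl₁⟩
  rintro rfl
  exact h0 (List.length_eq_zero_iff.1 e.symm)

/-- Since the generators preserve `K`, the intermediate points of the composition stay in `K`, so
the same word can be read in the induced generators. -/
theorem exists_compositions_inducedOn {K : Set T}
    (hK : ∀ g ∈ S, ∀ a b, (a, b) ∈ g → a ∈ K → b ∈ K) {n : ℕ} {R : SetRel T T}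
    (hR : R ∈ compositions S n) {a b : T} (hab : (a, b) ∈ R) (ha : a ∈ K) :
    ∃ hb : b ∈ K, ∃ R' ∈ compositions (inducedOn S K) n,
      ((⟨a, ha⟩, ⟨b, hb⟩) : K × K) ∈ R' := by
  obtain ⟨l, h0, h1, h2, rfl⟩ := hR
  have : ∀ l : List (SetRel T T), (∀ g ∈ l, g ∈ S) → ∀ (a : T) (ha : a ∈ K),
      (a, b) ∈ l.foldr SetRel.comp SetRel.id → ∃ hb : b ∈ K, ∃ l₁ : List (SetRel K K),
        l₁.length = l.length ∧ (∀ g ∈ l₁, g ∈ inducedOn S K) ∧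
        ((⟨a, ha⟩, ⟨b, hb⟩) : K × K) ∈ l₁.foldr SetRel.comp SetRel.id := by
    intro l
    induction l with
    | nil =>
      rintro - a ha (rfl : a = b)
      exact ⟨ha, [], rfl, by simp, rfl⟩
    | cons g l ih =>
      rintro hl a ha ⟨c, hac, hcb⟩
      have hg : g ∈ S := hl g (by simp)
      obtain ⟨hb, l₁, e, hl₁, h⟩ :=
        ih (fun g hg => hl g (by simp [hg])) c (hK g hg a c hac ha) hcb
      refine ⟨hb, {p : K × K | ((p.1 : T), (p.2 : T)) ∈ g} :: l₁, by simp [e], ?_,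
        ⟨c, hK g hg a c hac ha⟩, ?_, h⟩
      · intro h hh
        rcases List.mem_cons.1 hh with rfl | hh
        exacts [⟨g, hg, rfl⟩, hl₁ h hh]
      · exact hac
  obtain ⟨hb, l₁, e, hS, hl₁⟩ := this l h2 a ha hab
  refine ⟨hb, _, ⟨l₁, ?_, e.trans_le h1, hS, rfl⟩, hl₁⟩
  rintro rfl
  exact h0 (List.length_eq_zero_iff.1 e.symm)

/-! ### Local transformations and invariant measures. -/

theorem IsPartialBijection.comp {R R' : SetRel T T} (hR : IsPartialBijection R)
    (hR' : IsPartialBijection R') : IsPartialBijection (R.comp R') := by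
  constructor
  · rintro a b b' ⟨c, h1, h2⟩ ⟨c', h1', h2'⟩
    obtain rfl := hR.1 _ _ _ h1 h1'
    exact hR'.1 _ _ _ h2 h2'
  · rintro a a' b ⟨c, h1, h2⟩ ⟨c', h1', h2'⟩
    obtain rfl := hR'.2 _ _ _ h2 h2'
    exact hR.2 _ _ _ h1 h1'

/-- A local transformation: a homeomorphism between open subsets, given by its graph. -/
structure IsLocalTransformation [TopologicalSpace T] (R : SetRel T T) : Prop where
  bij : IsPartialBijection R
  isOpen_preimage : ∀ O, IsOpen O → IsOpen (R.preimage O)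
  isOpen_image : ∀ O, IsOpen O → IsOpen (R.image O)

theorem IsLocalTransformation.comp [TopologicalSpace T] {R R' : SetRel T T}
    (hR : IsLocalTransformation R) (hR' : IsLocalTransformation R') :
    IsLocalTransformation (R.comp R') where
  bij := hR.bij.comp hR'.bij
  isOpen_preimage O hO := by
    rw [SetRel.preimage_comp]
    exact hR.isOpen_preimage _ (hR'.isOpen_preimage _ hO)
  isOpen_image O hO := by
    rw [SetRel.image_comp]
    exact hR'.isOpen_image _ (hR.isOpen_image _ hO)

theorem IsLocalTransformation.isOpen_dom [TopologicalSpace T] {R : SetRel T T}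
    (hR : IsLocalTransformation R) : IsOpen R.dom := by
  rw [← SetRel.preimage_univ_right]
  exact hR.isOpen_preimage _ isOpen_univ

/-- Images of open sets are open, and injectivity makes images commute with relative complements, so
induction over the Borel sets applies. -/
theorem IsLocalTransformation.measurableSet_image [TopologicalSpace T] [MeasurableSpace T]
    [BorelSpace T] {R : SetRel T T} (hR : IsLocalTransformation R) {B : Set T}
    (hB : MeasurableSet B) : MeasurableSet (R.image B) := by
  induction B, hB using MeasurableSet.induction_on_open with
  | isOpen O hO => exact (hR.isOpen_image O hO).measurableSet
  | compl B hB ih =>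
    have : R.image Bᶜ = R.image univ \ R.image B := by
      ext b
      constructor
      · rintro ⟨a, ha, hab⟩
        refine ⟨⟨a, trivial, hab⟩, ?_⟩
        rintro ⟨a', ha', hab'⟩
        exact ha (hR.bij.2 _ _ _ hab hab' ▸ ha')
      · rintro ⟨⟨a, -, hab⟩, h⟩
        exact ⟨a, fun ha => h ⟨a, ha, hab⟩, hab⟩
    rw [this]
    exact (hR.isOpen_image _ isOpen_univ).measurableSet.diff ih
  | iUnion f _ _ ih =>
    rw [SetRel.image_iUnion]
    exact MeasurableSet.iUnion ih

/-- The set where a measurable map agrees with a local transformation is measurable. -/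
theorem IsLocalTransformation.measurableSet_agree [TopologicalSpace T]
    [SecondCountableTopology T] [T2Space T] [MeasurableSpace T] [BorelSpace T]
    {R : SetRel T T} (hR : IsLocalTransformation R) {f : T → T} (hf : Measurable f) :
    MeasurableSet {t | (t, f t) ∈ R} := by
  -- The only possible value of `R` at `t` equals `f t` as soon as it lies in every basic open set
  -- around `f t`, by Hausdorff separation. Countably many conditions suffice.
  have : {t | (t, f t) ∈ R} =
      R.dom ∩ ⋂ O ∈ countableBasis T, ((f ⁻¹' O)ᶜ ∪ R.preimage O) := by
    ext t
    simp only [mem_ofPred_eq, mem_inter_iff, mem_iInter, mem_union, mem_compl_iff, mem_preimage]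
    constructor
    · intro h
      refine ⟨⟨_, h⟩, fun O _ => ?_⟩
      by_cases hO : f t ∈ O
      exacts [.inr ⟨_, hO, h⟩, .inl hO]
    · rintro ⟨⟨b, hb⟩, h⟩
      suffices b = f t from this ▸ hb
      by_contra hne
      obtain ⟨O₁, O₂, -, hO₂, h₁, h₂, hd⟩ := t2_separation hne
      obtain ⟨O, hO, hO', hOs⟩ :=
        (isBasis_countableBasis T).exists_subset_of_mem_open h₂ hO₂
      rcases h O hO with h | ⟨b', hb', h⟩
      · exact h hO'
      · obtain rfl := hR.bij.1 _ _ _ hb h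
        exact disjoint_left.1 hd h₁ (hOs hb')
  rw [this]
  refine hR.isOpen_dom.measurableSet.inter
    (MeasurableSet.biInter (countable_countableBasis T) fun O hO => ?_)
  have hO := isOpen_of_mem_countableBasis hO
  exact (hf hO.measurableSet).compl.union (hR.isOpen_preimage O hO).measurableSet

/-- If a measurable map of a set `E` is given, at each point of the support of the measure, by one
of the compositions of at most `n` elements of `S`, then the measure of `E` is bounded by the
number of these compositions times the integral of a function not less than `1` on the image. -/
theorem measure_le_encard_compositions_mul_lintegral [TopologicalSpace T]
    [SecondCountableTopology T] [T2Space T] [MeasurableSpace T] [BorelSpace T] {Λ : Measure T}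
    (hS : S.Finite) (hloc : ∀ g ∈ S, IsLocalTransformation g)
    (hinv : IsInvariantMeasure (GeneratedPseudogroup S) Λ)
    (hK : ∀ g ∈ S, ∀ a b, (a, b) ∈ g → a ∈ Λ.support → b ∈ Λ.support)
    {n : ℕ} {E : Set T} (hE : MeasurableSet E) {f : T → T} (hf : Measurable f)
    (hfE : ∀ t ∈ E, ∃ R ∈ compositions S n, (t, f t) ∈ R)
    {w : T → ℝ≥0∞} (hw : ∀ t ∈ E, 1 ≤ w (f t)) :
    Λ E ≤ (compositions (inducedOn S Λ.support) n).encard * ∫⁻ t, w t ∂Λ := by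
  have hfin : (compositions (inducedOn S Λ.support) n).Finite :=
    finite_compositions (hS.image _) n
  -- Only the induced transformations are counted, so one extension `L R'` is fixed for each of
  -- them, even if several compositions induce the same one.
  choose! L hL hLsub using fun (R' : SetRel Λ.support Λ.support)
    (h : R' ∈ compositions (inducedOn S Λ.support) n) => exists_compositions_of_mem_inducedOn h
  have hLloc : ∀ R' ∈ compositions (inducedOn S Λ.support) n, IsLocalTransformation (L R') :=
    fun R' h => compositions_induction hloc (fun _ _ => .comp) (hL R' h)
  have hLgen : ∀ R' ∈ compositions (inducedOn S Λ.support) n, GeneratedPseudogroup S (L R') :=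
    fun R' h => compositions_induction .base .comp (hL R' h)
  have hpiece : ∀ R' ∈ compositions (inducedOn S Λ.support) n,
      Λ (E ∩ {t | (t, f t) ∈ L R'}) ≤ ∫⁻ t, w t ∂Λ := by
    intro R' h
    have hA : MeasurableSet (E ∩ {t | (t, f t) ∈ L R'}) :=
      hE.inter ((hLloc R' h).measurableSet_agree hf)
    -- The piece has the measure of its image under `L R'`, which is its image under `f`, and there
    -- `w` is at least `1`.
    rw [← hinv _ (hLgen R' h) _ hA fun t ht => ⟨f t, ht.2⟩,
      ← lintegral_indicator_one ((hLloc R' h).measurableSet_image hA)]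
    refine lintegral_mono fun b => indicator_le' (fun b hb => ?_) (fun _ _ => zero_le) b
    obtain ⟨t, ⟨htE, ht⟩, htb⟩ := hb
    rw [(hLloc R' h).bij.1 _ _ _ htb ht]
    exact hw t htE
  have hcover : E ⊆ (⋃ R' ∈ hfin.toFinset, E ∩ {t | (t, f t) ∈ L R'}) ∪ Λ.supportᶜ := by
    intro t ht
    by_cases htK : t ∈ Λ.support
    · obtain ⟨R, hR, htR⟩ := hfE t ht
      obtain ⟨hb, R', hR', h⟩ := exists_compositions_inducedOn hK hR htR htK
      exact .inl (mem_biUnion (hfin.mem_toFinset.2 hR') ⟨ht, hLsub R' hR' _ _ h⟩)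
    · exact .inr htK
  calc Λ E ≤ Λ (⋃ R' ∈ hfin.toFinset, E ∩ {t | (t, f t) ∈ L R'}) + Λ Λ.supportᶜ :=
        (measure_mono hcover).trans (measure_union_le _ _)
    _ ≤ ∑ R' ∈ hfin.toFinset, Λ (E ∩ {t | (t, f t) ∈ L R'}) := by
        -- The complement of the support is null because the space is second countable.
        rw [Measure.measure_compl_support, add_zero]
        exact measure_biUnion_finset_le _ _
    _ ≤ ∑ _R' ∈ hfin.toFinset, ∫⁻ t, w t ∂Λ :=
        Finset.sum_le_sum fun R' h => hpiece R' (hfin.mem_toFinset.1 h)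
    _ = _ := by
        rw [Finset.sum_const, nsmul_eq_mul, hfin.encard_eq_coe_toFinset_card]
        simp

/-- The support of an invariant measure is invariant. -/
theorem mem_support_of_mem [TopologicalSpace T] [MeasurableSpace T] [BorelSpace T]
    {Λ : Measure T} {R : SetRel T T} (hR : IsLocalTransformation R)
    (hinv : ∀ B, MeasurableSet B → B ⊆ R.dom → Λ (R.image B) = Λ B) {a b : T}
    (hab : (a, b) ∈ R) (ha : a ∈ Λ.support) : b ∈ Λ.support := by
  rw [Measure.mem_support_iff_forall] at ha ⊢
  intro N hN
  obtain ⟨O, hON, hO, hbO⟩ := mem_nhds_iff.1 hN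
  have h := hR.isOpen_preimage O hO
  calc 0 < Λ (R.preimage O) := ha _ (h.mem_nhds ⟨b, hbO, hab⟩)
    _ = Λ (R.image (R.preimage O)) := by
        refine (hinv _ h.measurableSet ?_).symm
        rintro a ⟨b, -, hab⟩
        exact ⟨b, hab⟩
    _ ≤ Λ N := by
        refine measure_mono ?_
        rintro b ⟨a, ⟨b', hb', hab'⟩, hab⟩
        exact hON (hR.bij.1 _ _ _ hab hab' ▸ hb')

end Relations

/-! Foliated charts and regular atlases -/

section Charts

variable {X : Type u} [TopologicalSpace X] (c : FoliatedChart X)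

theorem FoliatedChart.isOpen_source : IsOpen c.source := c.φ.open_source

theorem FoliatedChart.continuousOn_proj : ContinuousOn c.proj c.source :=
  continuous_snd.comp_continuousOn c.φ.continuousOn

theorem FoliatedChart.isOpen_image_proj {W : Set X} (hW : IsOpen W) (h : W ⊆ c.source) :
    IsOpen (c.proj '' W) := by
  have : c.proj '' W = Prod.snd '' (c.φ '' W) := (image_image Prod.snd c.φ W).symm
  rw [this]
  exact isOpenMap_snd _ (c.φ.isOpen_image_of_subset_source hW h)

/-- The point of the plaque of `s` in the centre of the ball. -/
def FoliatedChart.centralPoint (s : c.S) : X := c.φ.symm (c.center, s)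

theorem FoliatedChart.mk_mem_target (s : c.S) {b : EuclideanSpace ℝ (Fin c.dim)}
    (hb : b ∈ Metric.ball c.center c.radius) : (b, s) ∈ c.φ.target := by
  rw [c.target_eq]
  exact ⟨hb, mem_univ _⟩

theorem FoliatedChart.symm_mem_plaque (s : c.S) {b : EuclideanSpace ℝ (Fin c.dim)}
    (hb : b ∈ Metric.ball c.center c.radius) : c.φ.symm (b, s) ∈ c.plaque s := by
  have h := c.mk_mem_target s hb
  refine ⟨c.φ.map_target h, ?_⟩
  rw [FoliatedChart.proj, c.φ.right_inv h]

theorem FoliatedChart.centralPoint_mem_plaque (s : c.S) : c.centralPoint s ∈ c.plaque s :=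
  c.symm_mem_plaque s (Metric.mem_ball_self c.radius_pos)

theorem FoliatedChart.continuous_centralPoint : Continuous c.centralPoint :=
  c.φ.continuousOn_symm.comp_continuous (by fun_prop)
    fun s => c.mk_mem_target s (Metric.mem_ball_self c.radius_pos)

/-- A plaque is a continuous image of a ball. Connectedness is what later forces the boxes along a
plaque to form a chain. -/
theorem FoliatedChart.isPreconnected_plaque (s : c.S) : IsPreconnected (c.plaque s) := by
  have : c.plaque s = (fun b => c.φ.symm (b, s)) '' Metric.ball c.center c.radius := by
    ext x
    constructor
    · rintro ⟨hx, rfl⟩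
      have h := c.φ.map_source hx
      rw [c.target_eq] at h
      exact ⟨(c.φ x).1, h.1, c.φ.left_inv hx⟩
    · rintro ⟨b, hb, rfl⟩
      exact c.symm_mem_plaque s hb
  rw [this]
  exact (convex_ball _ _).isPreconnected.image _
    (c.φ.continuousOn_symm.comp (by fun_prop) fun b hb => c.mk_mem_target s hb)

end Charts

section Atlas

variable {X : Type u} [TopologicalSpace X] {F : Lamination X} (U : RegularAtlas F)

instance : PolishSpace U.Transversal :=
  inferInstanceAs (PolishSpace (Σ i, (U.chart i).S))

/-- The inclusion of the transverse model of a chart into the transversal. -/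
def RegularAtlas.inclusion (i : Fin U.card) (s : (U.chart i).S) : U.Transversal := ⟨i, s⟩

theorem RegularAtlas.continuous_inclusion (i : Fin U.card) : Continuous (U.inclusion i) :=
  continuous_sigmaMk (σ := fun i => (U.chart i).S) (i := i)

theorem RegularAtlas.isOpenMap_inclusion (i : Fin U.card) : IsOpenMap (U.inclusion i) :=
  isOpenMap_sigmaMk (σ := fun i => (U.chart i).S) (i := i)

theorem RegularAtlas.exists_mem_plaque (x : X) : ∃ t, x ∈ U.plaque t := by
  obtain ⟨i, hi⟩ := U.covers x
  exact ⟨⟨i, (U.chart i).proj x⟩, hi, rfl⟩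

/-- The embedding of the transversal into the space by the centres of the plaques. -/
def RegularAtlas.centralPoint (t : U.Transversal) : X := (U.chart t.1).centralPoint t.2

theorem RegularAtlas.centralPoint_mem_plaque (t : U.Transversal) :
    U.centralPoint t ∈ U.plaque t :=
  (U.chart t.1).centralPoint_mem_plaque t.2

theorem RegularAtlas.continuous_centralPoint : Continuous U.centralPoint :=
  continuous_sigma fun i => (U.chart i).continuous_centralPoint

theorem RegularAtlas.exists_mem_piece (x : X) : ∃ i, x ∈ U.piece i := by
  classical
  have h := U.covers x
  refine ⟨Fin.find _ h, Fin.find_spec h, ?_⟩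
  simp only [mem_iUnion, not_exists]
  rintro ⟨j, hj⟩ hx
  exact Fin.find_min h hj hx

theorem RegularAtlas.eq_of_mem_piece {x : X} {i j : Fin U.card} (hi : x ∈ U.piece i)
    (hj : x ∈ U.piece j) : i = j := by
  rcases lt_trichotomy i j with h | h | h
  · exact absurd (mem_iUnion.2 ⟨⟨i, h⟩, hi.1⟩) hj.2
  · exact h
  · exact absurd (mem_iUnion.2 ⟨⟨j, h⟩, hj.1⟩) hi.2

theorem RegularAtlas.measurableSet_piece [MeasurableSpace X] [BorelSpace X] (i : Fin U.card) :
    MeasurableSet (U.piece i) :=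
  (U.chart i).isOpen_source.measurableSet.diff
    (isOpen_iUnion fun j : {j // j < i} => (U.chart j).isOpen_source).measurableSet

/-- The transverse coordinate of a point in the first chart that contains it. -/
def RegularAtlas.retraction (x : X) : U.Transversal :=
  ⟨(U.exists_mem_piece x).choose, (U.chart _).proj x⟩

theorem RegularAtlas.mem_piece_retraction (x : X) : x ∈ U.piece (U.retraction x).1 :=
  (U.exists_mem_piece x).choose_spec

theorem RegularAtlas.mem_plaque_retraction (x : X) : x ∈ U.plaque (U.retraction x) :=
  ⟨(U.mem_piece_retraction x).1, rfl⟩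

theorem RegularAtlas.retraction_eq {x : X} {i : Fin U.card} (hx : x ∈ U.piece i) :
    U.retraction x = ⟨i, (U.chart i).proj x⟩ := by
  obtain rfl := U.eq_of_mem_piece (U.mem_piece_retraction x) hx
  rfl

/-- On each of the finitely many Borel pieces the retraction is the continuous projection of one
chart. -/
theorem RegularAtlas.measurable_retraction [MeasurableSpace X] [BorelSpace X] :
    Measurable U.retraction := by
  refine measurable_of_isOpen fun O hO => ?_
  have : U.retraction ⁻¹' O = ⋃ i, U.piece i ∩
      ((U.chart i).source ∩ (U.chart i).proj ⁻¹' (U.inclusion i ⁻¹' O)) := by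
    ext x
    simp only [mem_preimage, mem_iUnion, mem_inter_iff]
    constructor
    · intro h
      exact ⟨_, U.mem_piece_retraction x, (U.mem_piece_retraction x).1, h⟩
    · rintro ⟨i, hi, -, h⟩
      rwa [U.retraction_eq hi]
  rw [this]
  refine MeasurableSet.iUnion fun i => (U.measurableSet_piece i).inter ?_
  exact ((U.chart i).continuousOn_proj.isOpen_inter_preimage (U.chart i).isOpen_source
    (hO.preimage (U.continuous_inclusion i))).measurableSet

/-! ### Holonomy generators as local transformations. -/

theorem RegularAtlas.holonomy_inv (i j : Fin U.card) : (U.holonomy i j).inv = U.holonomy j i := by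
  ext ⟨a, b⟩
  constructor <;>
  · rintro ⟨x, hx, h⟩
    obtain ⟨rfl, rfl⟩ := Prod.mk.inj h
    exact ⟨x, hx.symm, rfl⟩

/-- The image is obtained by pulling back along one chart projection, which is continuous, and
pushing forward along another, which is open. -/
theorem RegularAtlas.isOpen_holonomy_image (i j : Fin U.card) {O : Set U.Transversal}
    (hO : IsOpen O) : IsOpen ((U.holonomy i j).image O) := by
  have : (U.holonomy i j).image O = U.inclusion j '' ((U.chart j).proj '' ((U.chart j).source ∩
      ((U.chart i).source ∩ (U.chart i).proj ⁻¹' (U.inclusion i ⁻¹' O)))) := by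
    ext b
    constructor
    · rintro ⟨a, ha, x, hx, h⟩
      obtain ⟨rfl, rfl⟩ := Prod.mk.inj h
      exact ⟨_, ⟨x, ⟨hx.2, hx.1, ha⟩, rfl⟩, rfl⟩
    · rintro ⟨_, ⟨x, ⟨hx, hx', ha⟩, rfl⟩, rfl⟩
      exact ⟨_, ha, x, ⟨hx', hx⟩, rfl⟩
  rw [this]
  refine U.isOpenMap_inclusion j _ ((U.chart j).isOpen_image_proj ?_ inter_subset_left)
  exact (U.chart j).isOpen_source.inter ((U.chart i).continuousOn_proj.isOpen_inter_preimage
    (U.chart i).isOpen_source (hO.preimage (U.continuous_inclusion i)))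

theorem RegularAtlas.isLocalTransformation_holonomy (i j : Fin U.card) :
    IsLocalTransformation (U.holonomy i j) where
  bij := U.holonomy_isPartialBijection i j
  isOpen_image _ hO := U.isOpen_holonomy_image i j hO
  isOpen_preimage O hO := by
    rw [← SetRel.image_inv, U.holonomy_inv]
    exact U.isOpen_holonomy_image j i hO

theorem isLocalTransformation_id_restrict {T : Type u} [TopologicalSpace T] {D : Set T}
    (hD : IsOpen D) : IsLocalTransformation ({p | p.1 = p.2 ∧ p.1 ∈ D} : SetRel T T) where
  bij := by
    constructor
    · exact fun _ _ _ h h' => h.1.symm.trans h'.1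
    · exact fun _ _ _ h h' => h.1.trans h'.1.symm
  isOpen_preimage O hO := by
    convert hO.inter hD using 1
    ext a
    simp [and_left_comm]
  isOpen_image O hO := by
    convert hO.inter hD using 1
    ext a
    simp only [SetRel.mem_image, mem_ofPred_eq, mem_inter_iff]
    constructor
    · rintro ⟨_, h1, rfl, h2⟩
      exact ⟨h1, h2⟩
    · rintro ⟨h1, h2⟩
      exact ⟨a, h1, rfl, h2⟩

theorem RegularAtlas.isLocalTransformation_of_mem_generators
    {g : SetRel U.Transversal U.Transversal} (hg : g ∈ U.generators) :
    IsLocalTransformation g := by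
  obtain ⟨i, j, -, rfl | rfl⟩ := hg
  · exact U.isLocalTransformation_holonomy i j
  · exact isLocalTransformation_id_restrict (U.isLocalTransformation_holonomy i j).isOpen_dom

theorem RegularAtlas.finite_generators : U.generators.Finite := by
  refine ((finite_range fun p : Fin U.card × Fin U.card => U.holonomy p.1 p.2).union
    (finite_range fun p : Fin U.card × Fin U.card =>
      ({q | q.1 = q.2 ∧ q.1 ∈ (U.holonomy p.1 p.2).dom} :
        SetRel U.Transversal U.Transversal))).subset ?_
  rintro g ⟨i, j, -, rfl | rfl⟩
  exacts [.inl ⟨(i, j), rfl⟩, .inr ⟨(i, j), rfl⟩]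

/-! Comparison of plaque chains with compositions of holonomy maps -/

/-- Any plaque of `x` is sent to any plaque of `y` by some composition of at most `n` generators of
the holonomy pseudogroup. -/
def RegularAtlas.WithinSteps (n : ℕ) (x y : X) : Prop :=
  ∀ t t', x ∈ U.plaque t → y ∈ U.plaque t' → ∃ R ∈ compositions U.generators n, (t, t') ∈ R

variable {U}

theorem RegularAtlas.WithinSteps.mono {m n : ℕ} {x y : X} (h : U.WithinSteps m x y)
    (hmn : m ≤ n) : U.WithinSteps n x y := fun t t' ht ht' =>
  let ⟨R, hR, h⟩ := h t t' ht ht'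
  ⟨R, compositions_mono _ hmn hR, h⟩

theorem RegularAtlas.WithinSteps.trans {m n : ℕ} {x y z : X} (h : U.WithinSteps m x y)
    (h' : U.WithinSteps n y z) : U.WithinSteps (m + n) x z := by
  intro t t' ht ht'
  obtain ⟨s, hs⟩ := U.exists_mem_plaque y
  obtain ⟨R, hR, hts⟩ := h t s ht hs
  obtain ⟨R', hR', hst⟩ := h' s t' hs ht'
  exact ⟨_, comp_mem_compositions hR hR', s, hts, hst⟩

theorem RegularAtlas.withinSteps_self (x : X) : U.WithinSteps 1 x x := by
  rintro ⟨i, s⟩ ⟨j, s'⟩ ⟨hi, hs⟩ ⟨hj, hs'⟩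
  refine ⟨_, mem_compositions_one ⟨i, j, ⟨x, hi, hj⟩, .inl rfl⟩, x, ⟨hi, hj⟩, ?_⟩
  dsimp only at hs hs'
  rw [hs, hs']

/-- One holonomy map passes to the common plaque at `x`, another leaves it at `y`. -/
theorem RegularAtlas.withinSteps_of_mem_plaque {t : U.Transversal} {x y : X} (hx : x ∈ U.plaque t)
    (hy : y ∈ U.plaque t) : U.WithinSteps 2 x y := by
  intro s s' hs hs'
  obtain ⟨R, hR, h⟩ := U.withinSteps_self x s t hs hx
  obtain ⟨R', hR', h'⟩ := U.withinSteps_self y t s' hy hs'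
  exact ⟨_, comp_mem_compositions hR hR', t, h, h'⟩

/-- If a connected set is covered by finitely many open sets which meet it in subsets of plaques,
then the number of steps between two of its points is bounded. -/
theorem RegularAtlas.withinSteps_of_isPreconnected {ι : Type*} [Fintype ι] {Q : ι → Set X}
    (hQ : ∀ a, IsOpen (Q a)) {P : Set X} (hP : IsPreconnected P) (hPQ : P ⊆ ⋃ a, Q a)
    (hplaque : ∀ a, ∀ x ∈ P ∩ Q a, ∀ y ∈ P ∩ Q a, U.WithinSteps 2 x y)
    {x y : X} (hx : x ∈ P) (hy : y ∈ P) : U.WithinSteps (2 * Fintype.card ι) x y := by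
  classical
  -- Two indices are adjacent when their sets overlap inside `P`.
  let G : SimpleGraph ι := SimpleGraph.fromRel fun a b => (P ∩ (Q a ∩ Q b)).Nonempty
  have hadj : ∀ a b, G.Adj a b → (P ∩ (Q a ∩ Q b)).Nonempty := by
    intro a b h
    rcases (SimpleGraph.fromRel_adj _ _ _).1 h with ⟨-, h | ⟨z, hz, hzb, hza⟩⟩
    exacts [h, ⟨z, hz, hza, hzb⟩]
  have hwalk : ∀ a b (w : G.Walk a b), ∀ x ∈ P ∩ Q a, ∀ y ∈ P ∩ Q b,
      U.WithinSteps (2 * (w.length + 1)) x y := by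
    intro a b w
    induction w with
    | nil => simpa using hplaque _
    | @cons a b c h w ih =>
      intro x hx y hy
      obtain ⟨z, hz, hza, hzb⟩ := hadj a b h
      refine ((hplaque a x hx z ⟨hz, hza⟩).trans (ih z ⟨hz, hzb⟩ y hy)).mono ?_
      rw [SimpleGraph.Walk.length_cons]
      omega
  obtain ⟨a, ha⟩ := mem_iUnion.1 (hPQ hx)
  obtain ⟨b, hb⟩ := mem_iUnion.1 (hPQ hy)
  have hab : G.Reachable a b := by
    by_contra hab
    -- Otherwise the sets reachable from `a` and the remaining ones would disconnect `P`.
    obtain ⟨z, hz, hz₁, hz₂⟩ := hP (⋃ d ∈ {d | G.Reachable a d}, Q d)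
      (⋃ d ∈ {d | ¬ G.Reachable a d}, Q d) (isOpen_biUnion fun d _ => hQ d)
      (isOpen_biUnion fun d _ => hQ d)
      (by
        intro z hz
        obtain ⟨d, hd⟩ := mem_iUnion.1 (hPQ hz)
        by_cases h : G.Reachable a d
        exacts [.inl (mem_biUnion h hd), .inr (mem_biUnion h hd)])
      ⟨x, hx, mem_biUnion (SimpleGraph.Reachable.refl a) ha⟩ ⟨y, hy, mem_biUnion hab hb⟩
    obtain ⟨d, hd, hzd⟩ := mem_iUnion₂.1 hz₁
    obtain ⟨e, he, hze⟩ := mem_iUnion₂.1 hz₂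
    refine he (SimpleGraph.Reachable.trans hd (SimpleGraph.Adj.reachable ?_))
    refine (SimpleGraph.fromRel_adj _ _ _).2 ⟨?_, .inl ⟨z, hz, hzd, hze⟩⟩
    rintro rfl
    exact he hd
  obtain ⟨w, hw⟩ := hab.exists_isPath
  -- A path repeats no vertex, so it visits at most `Fintype.card ι` sets, at two steps each.
  exact (hwalk a b w x ⟨hx, ha⟩ y ⟨hy, hb⟩).mono (by have := hw.length_lt; omega)

/-- Two points of the same plaque of a regular atlas are joined by a bounded number of holonomy maps
of another regular atlas. -/
theorem RegularAtlas.exists_withinSteps_of_mem_plaque [CompactSpace X] (U V : RegularAtlas F) :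
    ∃ N : ℕ, ∀ (t : V.Transversal), ∀ x ∈ V.plaque t, ∀ y ∈ V.plaque t,
      U.WithinSteps N x y := by
  -- Around each point there is a box in which the transverse coordinate of `V` determines that of
  -- `U`.
  have hbox : ∀ x : X, ∃ W : Set X, IsOpen W ∧ x ∈ W ∧ ∃ k i, W ⊆ (V.chart k).source ∧
      W ⊆ (U.chart i).source ∧ ∀ y ∈ W, ∀ z ∈ W, (V.chart k).proj y = (V.chart k).proj z →
        (U.chart i).proj y = (U.chart i).proj z := by
    intro x
    obtain ⟨k, hk⟩ := V.covers x
    obtain ⟨i, hi⟩ := U.covers x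
    obtain ⟨W, hW, hxW, hsub, g, -, hg⟩ :=
      F.compatible _ (V.chart_mem k) _ (U.chart_mem i) x ⟨hk, hi⟩
    refine ⟨W, hW, hxW, k, i, fun y hy => (hsub hy).1, fun y hy => (hsub hy).2, ?_⟩
    intro y hy z hz h
    rw [hg y hy, hg z hz, h]
  choose W hW hxW k i hWk hWi hWproj using hbox
  obtain ⟨A, hA⟩ := isCompact_univ.elim_finite_subcover W hW
    fun x _ => mem_iUnion.2 ⟨x, hxW x⟩
  refine ⟨2 * Fintype.card A, fun t x hx y hy => ?_⟩
  refine withinSteps_of_isPreconnected (Q := fun a : A => W a) (fun a => hW a)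
    ((V.chart t.1).isPreconnected_plaque t.2) (fun z _ => ?_) ?_ hx hy
  · obtain ⟨a, ha, hz⟩ := mem_iUnion₂.1 (hA (mem_univ z))
    exact mem_iUnion.2 ⟨⟨a, ha⟩, hz⟩
  · rintro a y ⟨hy, hya⟩ z ⟨hz, hza⟩
    -- The box may belong to another chart of `V`; by regularity the plaque `t` meets that chart in
    -- a single plaque, hence meets the box inside a single plaque of `U`.
    obtain ⟨s, hs⟩ := V.plaque_inter t.1 (k a) t.2 ⟨y, hy, hWk a hya⟩
    have h : (V.chart (k a)).proj y = (V.chart (k a)).proj z :=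
      (hs ⟨hy, hWk a hya⟩).2.trans (hs ⟨hz, hWk a hza⟩).2.symm
    exact withinSteps_of_mem_plaque (t := ⟨i a, (U.chart (i a)).proj z⟩)
      ⟨hWi a hya, hWproj a y hya z hza h⟩ ⟨hWi a hza, rfl⟩

/-- Each plaque costs `N` steps, and passing to the next plaque through a common point is free. -/
theorem RegularAtlas.IsPlaqueChain.withinSteps {V : RegularAtlas F} {N : ℕ}
    (hN : ∀ (t : V.Transversal), ∀ x ∈ V.plaque t, ∀ y ∈ V.plaque t, U.WithinSteps N x y)
    {l : List V.Transversal} (hl : V.IsPlaqueChain l) :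
    ∀ x ∈ ⋃ a ∈ l, V.plaque a, ∀ y ∈ ⋃ a ∈ l, V.plaque a, U.WithinSteps (N * l.length) x y := by
  induction l with
  | nil => simp
  | cons a l ih =>
    have ih := ih (List.IsChain.tail hl)
    have hend : ∀ y ∈ ⋃ a ∈ l, V.plaque a, ∃ p ∈ V.plaque a, p ∈ ⋃ a ∈ l, V.plaque a := by
      intro y hy
      cases l with
      | nil => simp at hy
      | cons b l =>
        obtain ⟨p, hpa, hpb⟩ := (List.isChain_cons_cons.1 hl).1
        exact ⟨p, hpa, mem_biUnion (by simp : b ∈ b :: l) hpb⟩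
    have hlen : N * (a :: l).length = N * l.length + N := by
      rw [List.length_cons, mul_add, mul_one]
    have hmem : ∀ x, x ∈ ⋃ b ∈ a :: l, V.plaque b →
        x ∈ V.plaque a ∨ x ∈ ⋃ b ∈ l, V.plaque b := by
      intro x hx
      obtain ⟨b, hb, hxb⟩ := mem_iUnion₂.1 hx
      rcases List.mem_cons.1 hb with rfl | hb
      exacts [.inl hxb, .inr (mem_biUnion hb hxb)]
    intro x hx y hy
    rw [hlen]
    rcases hmem x hx with hx | hx <;> rcases hmem y hy with hy | hy
    · exact (hN a x hx y hy).mono (by omega)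
    · obtain ⟨p, hpa, hpl⟩ := hend y hy
      exact ((hN a x hx p hpa).trans (ih p hpl y hy)).mono (by omega)
    · obtain ⟨p, hpa, hpl⟩ := hend x hx
      exact (ih x hx p hpl).trans (hN a p hpa y hy)
    · exact (ih x hx y hy).mono (by omega)

theorem RegularAtlas.withinSteps_of_pathLength_le {V : RegularAtlas F} {N : ℕ}
    (hN : ∀ (t : V.Transversal), ∀ x ∈ V.plaque t, ∀ y ∈ V.plaque t, U.WithinSteps N x y)
    {σ : unitInterval → X} {n : ℕ} (hσ : V.pathLength σ ≤ n) (s t : unitInterval) :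
    U.WithinSteps (N * n) (σ s) (σ t) := by
  -- The strict bound `n + 1` lets an actual chain be extracted from the infimum; its length is then
  -- at most `n`.
  have hlt : V.pathLength σ < (n + 1 : ℕ) := hσ.trans_lt (by exact_mod_cast n.lt_succ_self)
  simp only [RegularAtlas.pathLength, iInf_lt_iff] at hlt
  obtain ⟨l, ⟨hl, hsub⟩, hlen⟩ := hlt
  have hlen : l.length < n + 1 := by exact_mod_cast hlen
  exact (hl.withinSteps hN _ (hsub ⟨s, rfl⟩) _ (hsub ⟨t, rfl⟩)).mono
    (Nat.mul_le_mul_left _ (by omega))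

end Atlas

/-! The lower bound for the `Λ`-category -/

section LowerBound

variable {X : Type u} [TopologicalSpace X] {F : Lamination X} {U V : RegularAtlas F}
  {Λ : Measure U.Transversal}

theorem TangentialContraction.measure_le
    (hinv : IsInvariantMeasure U.holonomyPseudogroup Λ) {N : ℕ}
    (hN : ∀ (t : V.Transversal), ∀ x ∈ V.plaque t, ∀ y ∈ V.plaque t, U.WithinSteps N x y)
    {W : Opens X} (H : TangentialContraction F W) {n : ℕ} (hH : H.length V ≤ n) :
    Λ (U.centralPoint ⁻¹' W) ≤ (compositions (inducedOn U.generators Λ.support) (N * n)).encard *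
      U.transverseMeasure Λ H.finalSet := by
  classical
  borelize X
  have hEo : IsOpen (U.centralPoint ⁻¹' (W : Set X)) := W.isOpen.preimage U.continuous_centralPoint
  -- Outside the plaques with centre in `W` the value of `f` is irrelevant; the identity keeps it
  -- measurable.
  let f : U.Transversal → U.Transversal := fun t =>
    if h : t ∈ U.centralPoint ⁻¹' (W : Set X) then
      U.retraction (H.H (⟨U.centralPoint t, h⟩, 1)) else t
  have hfE : ∀ t (h : U.centralPoint t ∈ W), f t = U.retraction (H.H (⟨U.centralPoint t, h⟩, 1)) :=
    fun t h => dif_pos h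
  have hf : Measurable f := by
    refine Measurable.dite (s := U.centralPoint ⁻¹' (W : Set X))
      (f := fun t => U.retraction (H.H (⟨U.centralPoint t, t.2⟩, 1))) (g := fun t => (t : _))
      (U.measurable_retraction.comp (Continuous.measurable ?_)) measurable_subtype_coe
      hEo.measurableSet
    have := U.continuous_centralPoint
    fun_prop
  refine measure_le_encard_compositions_mul_lintegral U.finite_generators
    (fun g => U.isLocalTransformation_of_mem_generators) hinv (fun g hg a b => ?_)
    hEo.measurableSet hf (fun t ht => ?_) (fun t ht => ?_)
  · exact mem_support_of_mem (U.isLocalTransformation_of_mem_generators hg) (hinv g (.base g hg))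
  · rw [hfE t ht]
    have hlen := (le_iSup (fun x : W => V.pathLength fun s => H.H (x, s))
      ⟨U.centralPoint t, ht⟩).trans hH
    refine RegularAtlas.withinSteps_of_pathLength_le hN hlen 0 1 _ _ ?_
      (U.mem_plaque_retraction _)
    rw [H.initial]
    exact U.centralPoint_mem_plaque t
  -- The endpoint itself is counted at `f t`: the retraction uses the first chart containing it, as
  -- do the pieces in `transverseMeasure`.
  · rw [hfE t ht, ← ENat.toENNReal_one, ENat.toENNReal_le, one_le_encard_iff_nonempty]
    exact ⟨_, ⟨⟨_, rfl⟩, U.mem_piece_retraction _⟩, U.mem_plaque_retraction _⟩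

theorem measure_univ_div_le_catLE [CompactSpace X]
    (hinv : IsInvariantMeasure U.holonomyPseudogroup Λ) {N : ℕ}
    (hN : ∀ (t : V.Transversal), ∀ x ∈ V.plaque t, ∀ y ∈ V.plaque t, U.WithinSteps N x y)
    (n : ℕ) :
    Λ univ / (compositions (inducedOn U.generators Λ.support) (N * n)).encard ≤
      catLE U Λ V n := by
  refine le_iInf₂ fun 𝒲 h𝒲 => ?_
  -- The covering may be uncountable; subadditivity of Λ is applied to a finite subcover only.
  obtain ⟨A, hA⟩ := isCompact_univ.elim_finite_subcover (fun W : 𝒲 => ((W : Opens X) : Set X))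
    (fun W => (W : Opens X).isOpen) (by rw [← h𝒲, biUnion_eq_iUnion])
  have hcover : (univ : Set U.Transversal) ⊆
      ⋃ W ∈ A, U.centralPoint ⁻¹' ((W : Opens X) : Set X) := by
    intro t _
    obtain ⟨W, hW, h⟩ := mem_iUnion₂.1 (hA (mem_univ (U.centralPoint t)))
    exact mem_biUnion hW h
  have hM : Λ univ / (compositions (inducedOn U.generators Λ.support) (N * n)).encard ≤
      ∑ W ∈ A, Λ (U.centralPoint ⁻¹' ((W : Opens X) : Set X)) /
        (compositions (inducedOn U.generators Λ.support) (N * n)).encard := by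
    simp only [div_eq_mul_inv]
    rw [← Finset.sum_mul]
    gcongr
    exact (measure_mono hcover).trans (measure_biUnion_finset_le _ _)
  refine (hM.trans (Finset.sum_le_sum fun W _ => ?_)).trans (ENNReal.sum_le_tsum A)
  exact le_iInf₂ fun H hH => ENNReal.div_le_of_le_mul' (H.measure_le hinv hN hH)

end LowerBound

end MeasuredLamination

end

/-! ### Comparison of the growth types. -/

theorem propositionp {X : Type*} [TopologicalSpace X] [PolishSpace X] [CompactSpace X]
    (F : MeasuredLamination.Lamination X) (U V : MeasuredLamination.RegularAtlas F)
    (Λ : Measure U.Transversal) [Λ.Regular] (hΛ : Λ ≠ 0)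
    (hinv : MeasuredLamination.IsInvariantMeasure U.holonomyPseudogroup Λ)
    (hcat : MeasuredLamination.cat U Λ = 0) :
    MeasuredLamination.secondaryCat U Λ V ≤ MeasuredLamination.measureGrowth U.generators Λ := by
  obtain ⟨N, hN⟩ := U.exists_withinSteps_of_mem_plaque V
  -- The total mass may be infinite, so a finite positive `c` below it is used in its place.
  obtain ⟨c, hc0, hc⟩ : ∃ c : ℝ≥0, 0 < c ∧ (c : ℝ≥0∞) < Λ univ := by
    obtain ⟨c, hc0, hc⟩ := ENNReal.lt_iff_exists_nnreal_btwn.1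
      (pos_iff_ne_zero.2 (Measure.measure_univ_ne_zero.2 hΛ))
    exact ⟨c, by exact_mod_cast hc0, hc⟩
  change (_ : MeasuredLamination.GrowthSequence) ≤ _
  -- Inverting c / #S_{Nn} ≤ Cat(n) gives 1 / Cat(n) ≤ c⁻¹ · #S_{Nn}, also when a term is `0` or
  -- `∞`.
  refine ⟨N, c⁻¹, inv_pos.2 hc0, fun n => ?_⟩
  have h := (ENNReal.div_le_div_right hc.le _).trans
    (MeasuredLamination.measure_univ_div_le_catLE hinv hN n)
  refine (ENNReal.inv_le_inv.2 h).trans_eq ?_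
  rw [ENNReal.inv_div (.inr ENNReal.coe_ne_top) (.inr (by exact_mod_cast hc0.ne')),
    ENNReal.coe_inv hc0.ne', div_eq_mul_inv]
  exact mul_comm _ _
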